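/- Let $\mathcal C$ be a left cancellative small category, identified with its set of morphisms, with source and range maps $s,r$; the product $\alpha\beta$ is defined iff $s(\alpha)=r(\beta)$, and $\alpha\mathcal C=\{\alpha\beta : s(\alpha)=r(\beta)\}$. Assume that $\mathcal C$ is finitely aligned: for all $\alpha,\beta\in\mathcal C$ there is a finite (possibly empty) $F\subset\mathcal C$ with $\alpha\mathcal C\cap\beta\mathcal C=\bigcup_{\gamma\in F}\gamma\mathcal C$. Write $\alpha\vee\beta$ for any such $F$ that is independent, i.e. $\gamma\notin\gamma'\mathcal C$ for distinct $\gamma,\gamma'\in F$. A representation of $\mathcal C$ in a (not necessarily unital) $C^*$-algebra $B$ is a map $T:\mathcal C\to B$ with (1) $T_\alpha^*T_\alpha=T_{s(\alpha)}$; (2) $T_\alpha T_\beta=T_{\alpha\beta}$ if $s(\alpha)=r(\beta)$; (3) $T_\alpha T_\alpha^*T_\beta T_\beta^*=\bigvee_{\gamma\in\alpha\vee\beta}T_\gamma T_\gamma^*$ (join of projections; the empty join is $0$). A Toeplitz algebra of $\mathcal C$ is a pair $(\mathcal T(\mathcal C),t)$ of a $C^*$-algebra and a representation of $\mathcal C$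 in it such that for every representation $T$ of $\mathcal C$ in a $C^*$-algebra $B$ there is a unique $*$-homomorphism $\phi_T:\mathcal T(\mathcal C)\to B$ with $\phi_T\circ t=T$. Let $\tau_\alpha:s(\alpha)\mathcal C\to\alpha\mathcal C$, $\beta\mapsto\alpha\beta$. The zigzag inverse semigroup $\mathrm{ZM}(\mathcal C)$ is the inverse subsemigroup of the inverse semigroup $I(\mathcal C)$ of partial bijections of $\mathcal C$ generated by all $\tau_\alpha$ and the empty map $0$; write $\tau:\mathcal C\to \mathrm{ZM}(\mathcal C)$, $\alpha\mapsto\tau_\alpha$. A representation of $\mathrm{ZM}(\mathcal C)$ in $B$ is a map $\pi:\mathrm{ZM}(\mathcal C)\to B$ with $\pi(st)=\pi(s)\pi(t)$, $\pi(s^{-1})=\pi(s)^*$ and $\pi(0)=0$; $C^*(\mathrm{ZM}(\mathcal C))$, with canonical map $\iota$, is the $C^*$-algebra universal for these. A representation $\pi$ of $\mathrm{ZM}(\mathcal C)$ in $B$ is finitely join-preserving if, whenever $s\in\mathrm{ZM}(\mathcal C)$ is the union (the join in $I(\mathcal C)$) of a finite set $F\subset\mathrm{ZM}(\mathcal C)$,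 the element $\pi(s)$ is the join of $\pi(F)$ for the natural partial order ($a\le b$ iff $a=aa^*b$) of the partial isometries of $B$. Theorem. (i) For every representation $T$ of $\mathcal C$ in a $C^*$-algebra $B$ there is a unique finitely join-preserving representation $\pi_T$ of $\mathrm{ZM}(\mathcal C)$ in $B$ with $\pi_T\circ\tau=T$. Moreover there are a unique $*$-homomorphism $\widetilde{\pi_T}:C^*(\mathrm{ZM}(\mathcal C))\to B$ with $\widetilde{\pi_T}\circ\iota=\pi_T$ and a unique $*$-homomorphism $\phi_T:\mathcal T(\mathcal C)\to B$ with $\phi_T\circ t=T$, so that $\widetilde{\pi_T}\circ\iota\circ\tau=\pi_T\circ\tau=T=\phi_T\circ t$. (ii) For every $C^*$-algebra $B$, the map $T\mapsto\pi_T$ is a bijection from the representations of $\mathcal C$ in $B$ onto the finitely join-preserving representations of $\mathrm{ZM}(\mathcal C)$ in $B$. (iii) Consequently the Toeplitz algebra is universal for finitely join-preserving representations of $\mathrm{ZM}(\mathcal C)$: if $t$ is a representation of $\mathcal C$ in a $C^*$-algebra $A$, then $(A,t)$ is a Toeplitz algebra of $\mathcal C$ if and only if for every finitely join-preserving representation $\pi$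 of $\mathrm{ZM}(\mathcal C)$ in a $C^*$-algebra $B$ there is a unique $*$-homomorphism $\phi:A\to B$ with $\phi\circ\pi_t=\pi$. -/

import Mathlib

open CategoryTheory

universe w v u

namespace LCSC

/-!
A small category is a Mathlib category `O`; its elements (morphisms) are the elements of
`Arrow O`.  For `α : Arrow O` the source `s(α)` is `α.left`, the range `r(α)` is `α.right`, and
the composite `αβ` (defined when `s(α) = r(β)`, apply `β` first) is `β ≫ α` in Mathlib's notation.
A vertex is identified with the corresponding identity morphism.
-/

section Category

variable (O : Type u) [Category.{v} O]

/-- Left cancellation: `αβ = αγ` implies `β = γ`. -/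
class LeftCancellative : Prop where
  cancel : ∀ {x y z : O} (f : y ⟶ z) (g h : x ⟶ y), g ≫ f = h ≫ f → g = h

variable {O}

/-- `IsProd α β γ` says that `s(α) = r(β)` and `αβ = γ`. -/
def IsProd (α β γ : Arrow O) : Prop :=
  ∃ (x : O) (g : x ⟶ α.left), β = Arrow.mk g ∧ γ = Arrow.mk (g ≫ α.hom)

/-- The right ideal `α𝒞 = {αβ : s(α) = r(β)}`. -/
def rightIdeal (α : Arrow O) : Set (Arrow O) :=
  {γ | ∃ β, IsProd α β γ}

variable (O) in
/-- Finite alignment: every `α𝒞 ∩ β𝒞` is of the form `F𝒞` for a finite, possibly empty, `F`. -/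
def FinitelyAligned : Prop :=
  ∀ α β : Arrow O, ∃ F : Finset (Arrow O),
    rightIdeal α ∩ rightIdeal β = ⋃ γ ∈ F, rightIdeal γ

/-- `F` is a (choice of the) finite independent set `α ∨ β`. -/
def IsVee (α β : Arrow O) (F : Finset (Arrow O)) : Prop :=
  (∀ γ ∈ F, ∀ γ' ∈ F, γ ≠ γ' → γ ∉ rightIdeal γ') ∧
    rightIdeal α ∩ rightIdeal β = ⋃ γ ∈ F, rightIdeal γ

theorem IsProd.unique_right {α β γ γ' : Arrow O} (h : IsProd α β γ) (h' : IsProd α β γ') :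
    γ = γ' := by
  obtain ⟨x, g, rfl, rfl⟩ := h
  obtain ⟨x', g', e, rfl⟩ := h'
  obtain rfl : x = x' := congrArg (fun a : Arrow O => a.left) e
  rw [(Arrow.mk_inj _ _).1 e]

theorem IsProd.unique_mid [LeftCancellative O] {α β β' γ : Arrow O} (h : IsProd α β γ)
    (h' : IsProd α β' γ) : β = β' := by
  obtain ⟨x, g, rfl, rfl⟩ := h
  obtain ⟨x', g', rfl, e⟩ := h'
  obtain rfl : x = x' := congrArg (fun a : Arrow O => a.left) e
  rw [LeftCancellative.cancel _ _ _ ((Arrow.mk_inj _ _).1 e)]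

open Classical in
/-- The shift `τ_α : s(α)𝒞 → α𝒞`, `β ↦ αβ`, as a partial bijection of `𝒞`; its inverse is
`σ_α : αβ ↦ β`. -/
noncomputable def shift [LeftCancellative O] (α : Arrow O) : Arrow O ≃. Arrow O where
  toFun β := if h : ∃ γ, IsProd α β γ then some h.choose else none
  invFun γ := if h : ∃ β, IsProd α β γ then some h.choose else none
  inv β γ := by
    constructor
    · intro h
      split_ifs at h with h'
      have e : IsProd α β γ := by
        have := h'.choose_spec
        rwa [Option.some.inj h] at this
      have h2 : ∃ γ, IsProd α β γ := ⟨γ, e⟩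
      rw [dif_pos h2, h2.choose_spec.unique_right e]
    · intro h
      split_ifs at h with h'
      have e : IsProd α β γ := by
        have := h'.choose_spec
        rwa [Option.some.inj h] at this
      have h2 : ∃ β, IsProd α β γ := ⟨β, e⟩
      rw [dif_pos h2, h2.choose_spec.unique_mid e]

theorem shift_eq_some_iff [LeftCancellative O] (α β γ : Arrow O) :
    shift α β = some γ ↔ IsProd α β γ := by
  classical
  change (if h : ∃ γ, IsProd α β γ then some h.choose else none) = some γ ↔ _
  constructor
  · intro h
    split_ifs at h with h'
    have := h'.choose_spec
    rwa [Option.some.inj h] at this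
  · intro e
    have h2 : ∃ γ, IsProd α β γ := ⟨γ, e⟩
    rw [dif_pos h2, h2.choose_spec.unique_right e]

/-- Membership in the inverse subsemigroup of the symmetric inverse semigroup `I(𝒞)` (partial
bijections of `𝒞`) generated by all the shifts `τ_α` and the empty map. The product `ψφ` of `I(𝒞)`
(first `φ`, then `ψ`, on the largest possible domain) is `φ.trans ψ`. -/
inductive IsZigzagMap [LeftCancellative O] : (Arrow O ≃. Arrow O) → Prop
  | shift (α : Arrow O) : IsZigzagMap (shift α)
  | empty : IsZigzagMap ⊥
  | mul {ψ φ : Arrow O ≃. Arrow O} : IsZigzagMap ψ → IsZigzagMap φ → IsZigzagMap (φ.trans ψ)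
  | inv {φ : Arrow O ≃. Arrow O} : IsZigzagMap φ → IsZigzagMap φ.symm

variable (O) in
/-- The zigzag inverse semigroup `ZM(𝒞)`. -/
def ZM [LeftCancellative O] : Type (max u v) :=
  {φ : Arrow O ≃. Arrow O // IsZigzagMap φ}

variable [LeftCancellative O]

/-- The product `ψφ` of `ZM(𝒞)`. -/
instance : Mul (ZM O) := ⟨fun ψ φ => ⟨φ.1.trans ψ.1, ψ.2.mul φ.2⟩⟩

/-- The inverse (written `s*`) of the inverse semigroup `ZM(𝒞)`. -/
instance : Star (ZM O) := ⟨fun φ => ⟨φ.1.symm, φ.2.inv⟩⟩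

/-- The zero of `ZM(𝒞)`, the empty map. -/
instance : Zero (ZM O) := ⟨⟨⊥, .empty⟩⟩

/-- The map `τ : 𝒞 → ZM(𝒞)`. -/
noncomputable def tau (α : Arrow O) : ZM O := ⟨shift α, .shift α⟩

/-- `s` is the union (the join in the symmetric inverse semigroup) of the partial
bijections in `F`. -/
def IsUnion (F : Finset (ZM O)) (s : ZM O) : Prop :=
  ∀ x y : Arrow O, s.1 x = some y ↔ ∃ f ∈ F, f.1 x = some y

end Category

section CStar

variable {B : Type w} [NonUnitalCStarAlgebra B]

/-- `p` is the join of the projections in `X`: the least projection dominating each of them, where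
`e ≤ q` means `eq = e`. -/
def IsProjJoin (X : Set B) (p : B) : Prop :=
  IsStarProjection p ∧ (∀ e ∈ X, e * p = e) ∧
    ∀ q : B, IsStarProjection q → (∀ e ∈ X, e * q = e) → p * q = p

/-- Partial isometries. -/
def IsPartialIsometry (a : B) : Prop := a * star a * a = a

/-- The natural partial order of inverse semigroups, on partial isometries: `a = aa*b`. -/
def NatLE (a b : B) : Prop := a = a * star a * b

/-- `a` is the join of `X` for the natural partial order on the partial isometries of `B`. -/
def IsPartialIsometryJoin (X : Set B) (a : B) : Prop :=
  IsPartialIsometry a ∧ (∀ x ∈ X, NatLE x a) ∧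
    ∀ b : B, IsPartialIsometry b → (∀ x ∈ X, NatLE x b) → NatLE a b

variable {O : Type u} [Category.{v} O]

/-- Representations of a finitely aligned left cancellative small category in a
C*-algebra. -/
structure IsRep (T : Arrow O → B) : Prop where
  star_mul_self : ∀ α, star (T α) * T α = T (Arrow.mk (𝟙 α.left))
  mul : ∀ α β γ, IsProd α β γ → T α * T β = T γ
  range_mul : ∀ (α β : Arrow O) (F : Finset (Arrow O)), IsVee α β F →
    IsProjJoin ((fun γ => T γ * star (T γ)) '' (F : Set (Arrow O)))
      (T α * star (T α) * T β * star (T β))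

variable [LeftCancellative O]

/-- (Zero-preserving) representations of the inverse semigroup `ZM(𝒞)` in a C*-algebra. -/
structure IsZMRep (π : ZM O → B) : Prop where
  map_mul : ∀ s t, π (s * t) = π s * π t
  map_star : ∀ s, π (star s) = star (π s)
  map_zero : π 0 = 0

/-- Finitely join-preserving representations of `ZM(𝒞)`: if `s` is the join (that is, the union)
of a finite set `F` in `ZM(𝒞)`, then `π s` is the join of `π(F)`. -/
structure IsFJRep (π : ZM O → B) : Prop extends IsZMRep π where
  map_join : ∀ (F : Finset (ZM O)) (s : ZM O), IsUnion F s →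
    IsPartialIsometryJoin (π '' (F : Set (ZM O))) (π s)

/-- `(A, t)` is a Toeplitz algebra of `𝒞`: it is universal for representations of `𝒞`. -/
def IsToeplitzAlgebra (A : Type w) [NonUnitalCStarAlgebra A] (t : Arrow O → A) : Prop :=
  IsRep t ∧ ∀ (B : Type w) [NonUnitalCStarAlgebra B] (T : Arrow O → B), IsRep T →
    ∃! φ : A →⋆ₙₐ[ℂ] B, ∀ α, φ (t α) = T α

/-- `(A, ι)` is the full C*-algebra of `ZM(𝒞)`: it is universal for representations
of `ZM(𝒞)`. -/
def IsFullCStarAlgebra (A : Type w) [NonUnitalCStarAlgebra A] (ι : ZM O → A) : Prop :=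
  IsZMRep ι ∧ ∀ (B : Type w) [NonUnitalCStarAlgebra B] (π : ZM O → B), IsZMRep π →
    ∃! φ : A →⋆ₙₐ[ℂ] B, ∀ s, φ (ι s) = π s

/-- `(A, ρ)` is universal for finitely join-preserving representations of `ZM(𝒞)`. -/
def IsFJUniversal (A : Type w) [NonUnitalCStarAlgebra A] (ρ : ZM O → A) : Prop :=
  IsFJRep ρ ∧ ∀ (B : Type w) [NonUnitalCStarAlgebra B] (π : ZM O → B), IsFJRep π →
    ∃! φ : A →⋆ₙₐ[ℂ] B, ∀ s, φ (ρ s) = π s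

end CStar

end LCSC

/-! Write P_α = T_α T_α^*. A zigzag map φ can have many zigzag expressions, so its value is
characterised without choosing one: b implements φ if b T_β = T_{φ(β)} and b^* T_{φ(β)} = T_β on the
domain, and bc = 0 whenever T_β^* c = 0 for all β in the domain (`Implements`). The last condition
makes b unique (`Implements.unique`). Existence follows by induction over the generators. The only
hard case is a product, `Implements.trans`, where finite alignment and relation (3) enter.

Uniqueness then makes φ ↦ b multiplicative and *-preserving, and the annihilation condition gives
finite joins. Conversely, a finitely join-preserving π restricts along τ to a representation,
because the identity map of α𝒞 ∩ β𝒞 is the union of those of γ𝒞, γ ∈ α ∨ β. As the τ_α and 0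
generate, the two passages are mutually inverse, and the two universal properties coincide. -/

namespace LCSC

/-! ### Right ideals and calculus in the zigzag semigroup -/

section Category

variable {O : Type u} [Category.{v} O]

theorem isProd_id (α : Arrow O) : IsProd α (Arrow.mk (𝟙 α.left)) α :=
  ⟨α.left, 𝟙 _, rfl, by simp⟩

theorem id_isProd_iff (α β γ : Arrow O) :
    IsProd (Arrow.mk (𝟙 α.left)) β γ ↔ (∃ δ, IsProd α β δ) ∧ β = γ := by
  constructor
  · rintro ⟨x, g, rfl, rfl⟩
    exact ⟨⟨_, x, g, rfl, rfl⟩, by simp⟩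
  · rintro ⟨⟨δ, x, g, rfl, rfl⟩, rfl⟩
    exact ⟨x, g, rfl, by simp⟩

theorem IsProd.assoc {α β γ ξ δ : Arrow O} (h : IsProd α β γ) (h' : IsProd γ ξ δ) :
    ∃ ε, IsProd β ξ ε ∧ IsProd α ε δ := by
  obtain ⟨x, g, rfl, rfl⟩ := h
  obtain ⟨y, k, rfl, rfl⟩ := h'
  exact ⟨Arrow.mk (k ≫ g), ⟨y, k, rfl, rfl⟩, ⟨y, k ≫ g, rfl, by simp⟩⟩

theorem IsProd.assoc' {α β γ ξ ε : Arrow O} (h : IsProd α β γ) (h' : IsProd β ξ ε) :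
    ∃ δ, IsProd γ ξ δ ∧ IsProd α ε δ := by
  obtain ⟨x, g, rfl, rfl⟩ := h
  obtain ⟨y, k, rfl, rfl⟩ := h'
  exact ⟨Arrow.mk (k ≫ g ≫ α.hom), ⟨y, k, rfl, rfl⟩, ⟨y, k ≫ g, rfl, by simp⟩⟩

theorem self_mem_rightIdeal (α : Arrow O) : α ∈ rightIdeal α := ⟨_, isProd_id α⟩

theorem rightIdeal_subset {α β : Arrow O} (h : α ∈ rightIdeal β) :
    rightIdeal α ⊆ rightIdeal β := by
  rintro δ ⟨ξ, hξ⟩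
  obtain ⟨ζ, hζ⟩ := h
  obtain ⟨ε, -, h'⟩ := hζ.assoc hξ
  exact ⟨ε, h'⟩

/-- In a finitely aligned category the sets `α ∨ β` exist. -/
theorem FinitelyAligned.exists_isVee (hfa : FinitelyAligned O) (α β : Arrow O) :
    ∃ F, IsVee α β F := by
  classical
  -- A generating set of least cardinality is independent: a redundant element could be erased.
  let P : ℕ → Prop := fun n => ∃ F : Finset (Arrow O), F.card = n ∧
    rightIdeal α ∩ rightIdeal β = ⋃ γ ∈ F, rightIdeal γ
  have hP : ∃ n, P n := by
    obtain ⟨F, hF⟩ := hfa α β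
    exact ⟨_, F, rfl, hF⟩
  obtain ⟨F, hc, hF⟩ := Nat.find_spec hP
  refine ⟨F, fun γ hγ γ' hγ' hne hmem => ?_, hF⟩
  refine Nat.find_min hP (m := (F.erase γ).card) ?_ ⟨F.erase γ, rfl, ?_⟩
  · rw [← hc]
    exact Finset.card_erase_lt_of_mem hγ
  · rw [hF]
    apply subset_antisymm
    · intro δ hδ
      simp only [Set.mem_iUnion, exists_prop] at hδ ⊢
      obtain ⟨κ, hκ, h⟩ := hδ
      by_cases hk : κ = γ
      · subst hk
        exact ⟨γ', Finset.mem_erase.2 ⟨hne.symm, hγ'⟩, rightIdeal_subset hmem h⟩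
      · exact ⟨κ, Finset.mem_erase.2 ⟨hk, hκ⟩, h⟩
    · exact Set.biUnion_subset_biUnion_left fun x hx => Finset.mem_of_mem_erase hx

variable [LeftCancellative O]

theorem trans_eq_some_iff {X : Type*} (φ ψ : X ≃. X) (x z : X) :
    φ.trans ψ x = some z ↔ ∃ y, φ x = some y ∧ ψ y = some z :=
  PEquiv.mem_trans φ ψ x z

theorem symm_eq_some_iff {X : Type*} (φ : X ≃. X) {x y : X} :
    φ.symm x = some y ↔ φ y = some x :=
  PEquiv.eq_some_iff φ

/-- Zigzag maps and their inverses commute with right multiplication. -/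
theorem IsZigzagMap.equivariant {φ : Arrow O ≃. Arrow O} (hφ : IsZigzagMap φ)
    {α β : Arrow O} (h : φ β = some α) :
    (∀ ξ β', IsProd β ξ β' → ∃ α', IsProd α ξ α' ∧ φ β' = some α') ∧
      ∀ ξ α', IsProd α ξ α' → ∃ β', IsProd β ξ β' ∧ φ β' = some α' := by
  induction hφ generalizing α β with
  | shift μ =>
    simp only [shift_eq_some_iff] at h ⊢
    exact ⟨fun ξ β' hξ => h.assoc' hξ, fun ξ α' hξ => h.assoc hξ⟩
  | empty => simp at h
  | mul _ _ ihψ ihφ =>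
    rw [trans_eq_some_iff] at h
    obtain ⟨γ, h1, h2⟩ := h
    refine ⟨fun ξ β' hξ => ?_, fun ξ α' hξ => ?_⟩
    · obtain ⟨γ', hγ, e1⟩ := (ihφ h1).1 ξ β' hξ
      obtain ⟨α', hα, e2⟩ := (ihψ h2).1 ξ γ' hγ
      exact ⟨α', hα, (trans_eq_some_iff _ _ _ _).2 ⟨γ', e1, e2⟩⟩
    · obtain ⟨γ', hγ, e1⟩ := (ihψ h2).2 ξ α' hξ
      obtain ⟨β', hβ, e2⟩ := (ihφ h1).2 ξ γ' hγ
      exact ⟨β', hβ, (trans_eq_some_iff _ _ _ _).2 ⟨γ', e2, e1⟩⟩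
  | inv _ ih =>
    simp only [symm_eq_some_iff] at h ⊢
    exact ⟨(ih h).2, (ih h).1⟩

theorem ZM.ext {s t : ZM O} (h : ∀ x y, s.1 x = some y ↔ t.1 x = some y) : s = t :=
  Subtype.ext (PEquiv.ext fun x => Option.ext fun y => h x y)

theorem ZM.mul_apply (s t : ZM O) (x z : Arrow O) :
    (s * t).1 x = some z ↔ ∃ y, t.1 x = some y ∧ s.1 y = some z :=
  trans_eq_some_iff _ _ _ _

theorem ZM.star_apply (s : ZM O) (x y : Arrow O) : (star s).1 x = some y ↔ s.1 y = some x :=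
  symm_eq_some_iff _

theorem tau_apply (α x y : Arrow O) : (tau α).1 x = some y ↔ IsProd α x y :=
  shift_eq_some_iff _ _ _

theorem ZM.inj {s : ZM O} {x x' y : Arrow O} (h : s.1 x = some y) (h' : s.1 x' = some y) :
    x = x' :=
  s.1.inj h h'

/-- Two elements of `ZM` with one contained in the other satisfy `f = ff*s`. -/
theorem ZM.eq_mul_star_mul_of_le {f s : ZM O} (h : ∀ x y, f.1 x = some y → s.1 x = some y) :
    f = f * star f * s := by
  apply ZM.ext
  intro x y
  simp only [ZM.mul_apply, ZM.star_apply]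
  constructor
  · intro hf
    exact ⟨y, h _ _ hf, x, hf, hf⟩
  · rintro ⟨z, hs, w, hw, hw'⟩
    obtain rfl := Option.some.inj (hw.symm.trans hw')
    obtain rfl := ZM.inj (h _ _ hw) hs
    exact hw

theorem tau_star_mul_self (α : Arrow O) :
    star (tau α) * tau α = tau (Arrow.mk (𝟙 α.left)) := by
  apply ZM.ext
  intro x y
  simp only [ZM.mul_apply, ZM.star_apply, tau_apply, id_isProd_iff]
  constructor
  · rintro ⟨z, h, h'⟩
    exact ⟨⟨z, h⟩, h.unique_mid h'⟩
  · rintro ⟨⟨z, h⟩, rfl⟩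
    exact ⟨z, h, h⟩

theorem tau_mul {α β γ : Arrow O} (h : IsProd α β γ) : tau α * tau β = tau γ := by
  apply ZM.ext
  intro x y
  simp only [ZM.mul_apply, tau_apply]
  constructor
  · rintro ⟨z, h1, h2⟩
    obtain ⟨y', h3, h4⟩ := h.assoc' h1
    rwa [h2.unique_right h4]
  · intro h1
    obtain ⟨z, h2, h3⟩ := h.assoc h1
    exact ⟨z, h2, h3⟩

theorem tau_mul_star_apply (α x y : Arrow O) :
    (tau α * star (tau α)).1 x = some y ↔ x ∈ rightIdeal α ∧ x = y := by
  simp only [ZM.mul_apply, ZM.star_apply, tau_apply]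
  constructor
  · rintro ⟨z, h, h'⟩
    exact ⟨⟨z, h⟩, h.unique_right h'⟩
  · rintro ⟨⟨z, h⟩, rfl⟩
    exact ⟨z, h, h⟩

theorem tau_range_mul_apply (α β x y : Arrow O) :
    (tau α * star (tau α) * (tau β * star (tau β))).1 x = some y ↔
      x ∈ rightIdeal α ∩ rightIdeal β ∧ x = y := by
  rw [ZM.mul_apply]
  simp only [tau_mul_star_apply, Set.mem_inter_iff]
  constructor
  · rintro ⟨z, ⟨h, rfl⟩, h', rfl⟩
    exact ⟨⟨h', h⟩, rfl⟩
  · rintro ⟨⟨h, h'⟩, rfl⟩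
    exact ⟨x, ⟨h', rfl⟩, h, rfl⟩

end Category

/-! ### Commuting projections in a C*-algebra -/

section CStar

variable {B : Type w} [NonUnitalCStarAlgebra B]

theorem eq_zero_of_mul_star_mul_eq_zero {a c : B} (h : a * (star a * c) = 0) :
    star a * c = 0 := by
  rw [← CStarRing.star_mul_self_eq_zero_iff, star_mul, star_star, mul_assoc, h, mul_zero]

/-- Finitely many commuting projections have an upper bound that annihilates whatever they all
annihilate. -/
theorem exists_upperBound_of_commute {ι : Type*} (F : Finset ι) (e : ι → B)
    (he : ∀ i, IsStarProjection (e i)) (hc : ∀ i j, Commute (e i) (e j)) :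
    ∃ q : B, IsStarProjection q ∧ (∀ i ∈ F, e i * q = e i) ∧ (∀ j, Commute (e j) q) ∧
      ∀ d, (∀ i ∈ F, e i * d = 0) → q * d = 0 := by
  classical
  induction F using Finset.induction_on with
  | empty => exact ⟨0, .zero B, by simp, fun j => Commute.zero_right _, by simp⟩
  | insert i F _ ih =>
    obtain ⟨q, hq, hle, hcomm, hann⟩ := ih
    have hi := (he i).isIdempotentElem.eq
    have hqq := hq.isIdempotentElem.eq
    -- The join of two commuting projections.
    refine ⟨q + e i - q * e i, ⟨?_, ?_⟩, ?_, ?_, ?_⟩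
    · have h1 : q * e i = e i * q := (hcomm i).symm.eq
      have h2 : q * (q * e i) = q * e i := by rw [← mul_assoc, hqq]
      have h3 : e i * (q * e i) = q * e i := by rw [← mul_assoc, ← h1, mul_assoc, hi]
      have h4 : q * e i * q = q * e i := by rw [h1, mul_assoc, hqq]
      have h5 : q * e i * e i = q * e i := by rw [mul_assoc, hi]
      have h6 : q * e i * (q * e i) = q * e i := by rw [mul_assoc, h3, h2]
      change (q + e i - q * e i) * (q + e i - q * e i) = _
      rw [sub_mul, add_mul, mul_sub, mul_sub, mul_sub, mul_add, mul_add, mul_add,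
        h2, h3, h4, h5, h6, hqq, hi, ← h1]
      abel
    · have h1 := hq.isSelfAdjoint.star_eq
      have h2 := (he i).isSelfAdjoint.star_eq
      change star _ = _
      rw [star_sub, star_add, star_mul, h1, h2, (hcomm i).eq]
    · intro j hj
      rcases Finset.mem_insert.1 hj with rfl | hj
      · rw [mul_sub, mul_add, ← mul_assoc, (hcomm j).eq, mul_assoc, hi]
        abel
      · rw [mul_sub, mul_add, ← mul_assoc, hle j hj]
        abel
    · intro j
      exact ((hcomm j).add_right (hc j i)).sub_right ((hcomm j).mul_right (hc j i))
    · intro d hd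
      have h1 := hann d fun j hj => hd j (Finset.mem_insert_of_mem hj)
      have h2 := hd i (Finset.mem_insert_self _ _)
      rw [sub_mul, add_mul, mul_assoc, h1, h2, mul_zero, add_zero, sub_zero]

/-- Leastness gives p = pq for the upper bound q built from the e i, and qd = 0. -/
theorem IsProjJoin.mul_eq_zero {ι : Type*} {F : Finset ι} {e : ι → B} {p : B}
    (hp : IsProjJoin (e '' (F : Set ι)) p)
    (he : ∀ i, IsStarProjection (e i)) (hc : ∀ i j, Commute (e i) (e j)) {d : B}
    (hd : ∀ i ∈ F, e i * d = 0) : p * d = 0 := by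
  obtain ⟨q, hq, hle, -, hann⟩ := exists_upperBound_of_commute F e he hc
  have h := hp.2.2 q hq (by rintro _ ⟨i, hi, rfl⟩; exact hle i hi)
  rw [← h, mul_assoc, hann d hd, mul_zero]

/-! ### Representations of the category and implementing elements -/

variable {O : Type u} [Category.{v} O]

theorem IsRep.isStarProjection_id {T : Arrow O → B} (hT : IsRep T) (x : O) :
    IsStarProjection (T (Arrow.mk (𝟙 x))) := by
  have h : star (T (Arrow.mk (𝟙 x))) * T (Arrow.mk (𝟙 x)) = T (Arrow.mk (𝟙 x)) :=
    hT.star_mul_self (Arrow.mk (𝟙 x))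
  have hs : star (T (Arrow.mk (𝟙 x))) = T (Arrow.mk (𝟙 x)) := by
    rw [← h]; simp
  refine ⟨?_, hs⟩
  rwa [hs] at h

theorem IsRep.mul_id {T : Arrow O → B} (hT : IsRep T) (α : Arrow O) :
    T α * T (Arrow.mk (𝟙 α.left)) = T α :=
  hT.mul _ _ _ (isProd_id α)

theorem IsRep.mul_star_mul {T : Arrow O → B} (hT : IsRep T) (α : Arrow O) :
    T α * (star (T α) * T α) = T α := by
  rw [hT.star_mul_self, hT.mul_id]

theorem IsRep.star_mul_of_isProd {T : Arrow O → B} (hT : IsRep T) {α β γ : Arrow O}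
    (h : IsProd α β γ) : star (T α) * T γ = T β := by
  rw [← hT.mul _ _ _ h, ← mul_assoc, hT.star_mul_self]
  exact hT.mul _ _ _ ((id_isProd_iff _ _ _).2 ⟨⟨_, h⟩, rfl⟩)

theorem IsRep.isStarProjection_range {T : Arrow O → B} (hT : IsRep T) (α : Arrow O) :
    IsStarProjection (T α * star (T α)) := by
  refine ⟨?_, ?_⟩
  · change T α * star (T α) * (T α * star (T α)) = _
    rw [← mul_assoc, mul_assoc (T α), hT.mul_star_mul]
  · change star _ = _
    simp

/-- Relation (3) makes P_α P_β a projection; its self-adjointness is commutation. -/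
theorem IsRep.commute_range (hfa : FinitelyAligned O) {T : Arrow O → B} (hT : IsRep T)
    (α β : Arrow O) : Commute (T α * star (T α)) (T β * star (T β)) := by
  obtain ⟨F, hF⟩ := hfa.exists_isVee α β
  have h := (hT.range_mul α β F hF).1.isSelfAdjoint.star_eq
  simp only [star_mul, star_star] at h
  change _ * _ = _ * _
  simp only [mul_assoc] at h ⊢
  exact h.symm

/-- `b` behaves as the value at `φ` of an extension of `T`: it implements `φ` on the `T β`, and it
vanishes on whatever is orthogonal to the ranges of all `T β` with `β` in the domain of `φ`. -/
structure Implements (T : Arrow O → B) (φ : Arrow O ≃. Arrow O) (b : B) : Prop where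
  map : ∀ β α, φ β = some α → b * T β = T α
  star_map : ∀ β α, φ β = some α → star b * T α = T β
  ann : ∀ c, (∀ β α, φ β = some α → star (T β) * c = 0) → b * c = 0

/-- Both b and b' kill (b - b')^*, so (b - b')(b - b')^* = 0. -/
theorem Implements.unique {T : Arrow O → B} {φ : Arrow O ≃. Arrow O} {b b' : B}
    (h : Implements T φ b) (h' : Implements T φ b') : b = b' := by
  have key : ∀ β α, φ β = some α → star (T β) * star (b - b') = 0 := by
    intro β α e
    rw [← star_mul, sub_mul, h.map _ _ e, h'.map _ _ e, sub_self, star_zero]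
  have : (b - b') * star (b - b') = 0 := by
    rw [sub_mul, h.ann _ key, h'.ann _ key, sub_zero]
  exact sub_eq_zero.1 ((CStarRing.mul_star_self_eq_zero_iff _).1 this)

theorem Implements.symm {T : Arrow O → B} {φ : Arrow O ≃. Arrow O} {b : B}
    (h : Implements T φ b) : Implements T φ.symm (star b) where
  map α β e := h.star_map _ _ ((symm_eq_some_iff _).1 e)
  star_map α β e := by
    rw [star_star]
    exact h.map _ _ ((symm_eq_some_iff _).1 e)
  ann c hc := by
    refine eq_zero_of_mul_star_mul_eq_zero (h.ann _ fun β α e => ?_)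
    rw [← mul_assoc, ← star_mul, h.map _ _ e]
    exact hc α β ((symm_eq_some_iff _).2 e)

theorem implements_bot (T : Arrow O → B) : Implements T ⊥ 0 where
  map β α e := by simp at e
  star_map β α e := by simp at e
  ann c _ := zero_mul c

variable [LeftCancellative O]

theorem implements_shift {T : Arrow O → B} (hT : IsRep T) (α : Arrow O) :
    Implements T (shift α) (T α) where
  map β γ e := hT.mul _ _ _ ((shift_eq_some_iff _ _ _).1 e)
  star_map β γ e := hT.star_mul_of_isProd ((shift_eq_some_iff _ _ _).1 e)
  ann c hc := by
    -- The vertex s(α) lies in the domain of τ_α and alone forces T_α c = 0.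
    have h := hc _ _ ((shift_eq_some_iff _ _ _).2 (isProd_id α))
    rw [(hT.isStarProjection_id _).isSelfAdjoint.star_eq] at h
    rw [← hT.mul_id, mul_assoc, h, mul_zero]

/-- Let T_β^* c = 0 on the domain of ψφ. It suffices that T_γ^* bc = 0 for γ in the domain of ψ. For
α in the range of φ, P_α P_γ is the join of the P_κ, κ ∈ α ∨ γ. By equivariance such κ lie in the
range of φ and the domain of ψ, so T_κ^* bc = T_β^* c = 0 where φ(β) = κ. -/
theorem Implements.trans (hfa : FinitelyAligned O) {T : Arrow O → B} (hT : IsRep T)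
    {φ ψ : Arrow O ≃. Arrow O} (hφ : IsZigzagMap φ) (hψ : IsZigzagMap ψ) {a b : B}
    (hb : Implements T φ b) (ha : Implements T ψ a) : Implements T (φ.trans ψ) (a * b) where
  map β γ e := by
    obtain ⟨α, h1, h2⟩ := (trans_eq_some_iff _ _ _ _).1 e
    rw [mul_assoc, hb.map _ _ h1, ha.map _ _ h2]
  star_map β γ e := by
    obtain ⟨α, h1, h2⟩ := (trans_eq_some_iff _ _ _ _).1 e
    rw [star_mul, mul_assoc, ha.star_map _ _ h2, hb.star_map _ _ h1]
  ann c hc := by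
    rw [mul_assoc]
    refine ha.ann _ fun γ γ' hγ => ?_
    have hκ : ∀ κ β γ, φ β = some κ → ψ κ = some γ → star (T κ) * (b * c) = 0 := by
      intro κ β γ h1 h2
      have := hc β γ ((trans_eq_some_iff _ _ _ _).2 ⟨κ, h1, h2⟩)
      rwa [← hb.star_map _ _ h1, star_mul, star_star, mul_assoc] at this
    have hrange : star b * (T γ * star (T γ) * (b * c)) = 0 := by
      refine hb.symm.ann _ fun α β e => ?_
      rw [symm_eq_some_iff] at e
      obtain ⟨F, hF⟩ := hfa.exists_isVee α γ
      have h0 := (hT.range_mul α γ F hF).mul_eq_zero (d := b * c)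
        hT.isStarProjection_range (hT.commute_range hfa) (by
          intro κ hκF
          have hmem : κ ∈ rightIdeal α ∩ rightIdeal γ := by
            rw [hF.2]
            exact Set.mem_biUnion hκF (self_mem_rightIdeal κ)
          obtain ⟨⟨ξ, hξ⟩, ⟨ζ, hζ⟩⟩ := hmem
          obtain ⟨β', -, e1⟩ := (hφ.equivariant e).2 _ _ hξ
          obtain ⟨γ'', -, e2⟩ := (hψ.equivariant hγ).1 _ _ hζ
          rw [mul_assoc, hκ _ _ _ e1 e2, mul_zero])
      have h1 : T α * (star (T α) * (T γ * star (T γ) * (b * c))) = 0 := by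
        simpa only [mul_assoc] using h0
      exact eq_zero_of_mul_star_mul_eq_zero h1
    -- This is c^* b^* P_γ b c, so the C*-identity finishes.
    have h2 : star (star (T γ) * (b * c)) * (star (T γ) * (b * c)) = 0 := by
      have : star c * (star b * (T γ * star (T γ) * (b * c))) = 0 := by rw [hrange, mul_zero]
      simpa only [star_mul, star_star, mul_assoc] using this
    exact (CStarRing.star_mul_self_eq_zero_iff _).1 h2

theorem IsZigzagMap.exists_implements (hfa : FinitelyAligned O) {T : Arrow O → B} (hT : IsRep T)
    {φ : Arrow O ≃. Arrow O} (hφ : IsZigzagMap φ) : ∃ b, Implements T φ b := by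
  induction hφ with
  | shift α => exact ⟨_, implements_shift hT α⟩
  | empty => exact ⟨_, implements_bot T⟩
  | mul hψ hφ ihψ ihφ =>
    obtain ⟨a, ha⟩ := ihψ
    obtain ⟨b, hb⟩ := ihφ
    exact ⟨_, hb.trans hfa hT hφ hψ ha⟩
  | inv _ ih =>
    obtain ⟨b, hb⟩ := ih
    exact ⟨_, hb.symm⟩

/-- The extension of a representation of the category to `ZM`. -/
noncomputable def IsRep.extend (hfa : FinitelyAligned O) {T : Arrow O → B} (hT : IsRep T)
    (s : ZM O) : B :=
  (s.2.exists_implements hfa hT).choose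

theorem IsRep.implements_extend (hfa : FinitelyAligned O) {T : Arrow O → B} (hT : IsRep T)
    (s : ZM O) : Implements T s.1 (hT.extend hfa s) :=
  (s.2.exists_implements hfa hT).choose_spec

theorem IsRep.extend_tau (hfa : FinitelyAligned O) {T : Arrow O → B} (hT : IsRep T)
    (α : Arrow O) : hT.extend hfa (tau α) = T α :=
  (hT.implements_extend hfa (tau α)).unique (implements_shift hT α)

/-! ### Extension to the zigzag semigroup, and restriction back -/

theorem IsZMRep.isPartialIsometry {π : ZM O → B} (hπ : IsZMRep π) (s : ZM O) :
    IsPartialIsometry (π s) := by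
  change π s * star (π s) * π s = π s
  rw [← hπ.map_star, ← hπ.map_mul, ← hπ.map_mul,
    ← ZM.eq_mul_star_mul_of_le (f := s) (s := s) fun _ _ h => h]

theorem IsRep.isZMRep_extend (hfa : FinitelyAligned O) {T : Arrow O → B} (hT : IsRep T) :
    IsZMRep (hT.extend hfa) where
  map_mul s t := (hT.implements_extend hfa (s * t)).unique
    ((hT.implements_extend hfa t).trans hfa hT t.2 s.2 (hT.implements_extend hfa s))
  map_star s := (hT.implements_extend hfa (star s)).unique (hT.implements_extend hfa s).symm
  map_zero := (hT.implements_extend hfa 0).unique (implements_bot T)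

theorem IsRep.isFJRep_extend (hfa : FinitelyAligned O) {T : Arrow O → B} (hT : IsRep T) :
    IsFJRep (hT.extend hfa) where
  toIsZMRep := hT.isZMRep_extend hfa
  map_join F s hs := by
    have hπ := hT.isZMRep_extend hfa
    refine ⟨hπ.isPartialIsometry s, ?_, ?_⟩
    · rintro _ ⟨f, hf, rfl⟩
      change _ = _
      rw [← hπ.map_star, ← hπ.map_mul, ← hπ.map_mul,
        ← ZM.eq_mul_star_mul_of_le fun x y h => (hs x y).2 ⟨f, hf, h⟩]
    · intro b _ hb
      -- Each α in the range of s lies in the range of some f ∈ F, and π(f)^* b = π(f)^* π(s); hence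
      -- T_α^* kills b - π(s).
      have key : star (hT.extend hfa s) * (b - hT.extend hfa s) = 0 := by
        refine (hT.implements_extend hfa s).symm.ann _ fun α β e => ?_
        rw [symm_eq_some_iff] at e
        obtain ⟨f, hf, hfe⟩ := (hs _ _).1 e
        have hle : hT.extend hfa f =
            hT.extend hfa f * star (hT.extend hfa f) * hT.extend hfa s := by
          rw [← hπ.map_star, ← hπ.map_mul, ← hπ.map_mul,
            ← ZM.eq_mul_star_mul_of_le fun x y h => (hs x y).2 ⟨f, hf, h⟩]
        have hle' : hT.extend hfa f = hT.extend hfa f * star (hT.extend hfa f) * b :=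
          hb _ ⟨f, hf, rfl⟩
        have h0 : hT.extend hfa f *
            (star (hT.extend hfa f) * (b - hT.extend hfa s)) = 0 := by
          rw [← mul_assoc, mul_sub, ← hle, ← hle', sub_self]
        rw [← (hT.implements_extend hfa f).map _ _ hfe, star_mul, mul_assoc,
          eq_zero_of_mul_star_mul_eq_zero h0, mul_zero]
      change _ = _
      rw [mul_sub, sub_eq_zero] at key
      rw [mul_assoc, key, ← mul_assoc]
      exact (hπ.isPartialIsometry s).symm

theorem IsZMRep.eq_of_tau {π ρ : ZM O → B} (hπ : IsZMRep π) (hρ : IsZMRep ρ)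
    (h : ∀ α, π (tau α) = ρ (tau α)) : π = ρ := by
  funext ⟨φ, hφ⟩
  induction hφ with
  | shift α => exact h α
  | empty => exact hπ.map_zero.trans hρ.map_zero.symm
  | mul hψ hφ ihψ ihφ =>
    exact (hπ.map_mul ⟨_, hψ⟩ ⟨_, hφ⟩).trans
      ((congrArg₂ (· * ·) ihψ ihφ).trans (hρ.map_mul ⟨_, hψ⟩ ⟨_, hφ⟩).symm)
  | inv hφ ih =>
    exact (hπ.map_star ⟨_, hφ⟩).trans ((congrArg star ih).trans (hρ.map_star ⟨_, hφ⟩).symm)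

theorem IsZMRep.comp {A : Type w} [NonUnitalCStarAlgebra A] {ρ : ZM O → A} (hρ : IsZMRep ρ)
    (φ : A →⋆ₙₐ[ℂ] B) : IsZMRep fun s => φ (ρ s) where
  map_mul s t := by rw [hρ.map_mul, _root_.map_mul]
  map_star s := by rw [hρ.map_star, StarHomClass.map_star]
  map_zero := by rw [hρ.map_zero, _root_.map_zero]

theorem IsFJRep.isRep_tau {π : ZM O → B} (hπ : IsFJRep π) : IsRep fun α => π (tau α) where
  star_mul_self α := by rw [← hπ.map_star, ← hπ.map_mul, tau_star_mul_self]
  mul α β γ h := by rw [← hπ.map_mul, tau_mul h]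
  range_mul α β F hF := by
    classical
    set s : ZM O := tau α * star (tau α) * (tau β * star (tau β)) with hs
    have hval : π (tau α) * star (π (tau α)) * π (tau β) * star (π (tau β)) = π s := by
      rw [hs, hπ.map_mul, hπ.map_mul, hπ.map_mul, hπ.map_star, hπ.map_star, mul_assoc (_ * _)]
    have hstar : star s = s := by
      apply ZM.ext
      intro x y
      rw [ZM.star_apply, hs, tau_range_mul_apply, tau_range_mul_apply]
      constructor
      · rintro ⟨h, rfl⟩
        exact ⟨h, rfl⟩
      · rintro ⟨h, rfl⟩
        exact ⟨h, rfl⟩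
    have hidem : s * s = s := by
      apply ZM.ext
      intro x y
      rw [ZM.mul_apply, hs]
      simp only [tau_range_mul_apply]
      constructor
      · rintro ⟨z, ⟨h, rfl⟩, -, rfl⟩
        exact ⟨h, rfl⟩
      · rintro ⟨h, rfl⟩
        exact ⟨x, ⟨h, rfl⟩, h, rfl⟩
    have hproj : IsStarProjection (π s) :=
      ⟨by change _ * _ = _; rw [← hπ.map_mul, hidem],
        by change star _ = _; rw [← hπ.map_star, hstar]⟩
    have hrange : ∀ γ, IsStarProjection (π (tau γ) * star (π (tau γ))) := by
      intro γ
      refine ⟨?_, ?_⟩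
      · change _ * _ = _
        rw [← mul_assoc]
        exact congrArg (· * star (π (tau γ))) (hπ.isPartialIsometry (tau γ))
      · change star _ = _
        simp
    have hU : IsUnion (F.image fun γ => tau γ * star (tau γ)) s := by
      intro x y
      rw [hs, tau_range_mul_apply, hF.2]
      simp only [Finset.mem_image, exists_exists_and_eq_and, tau_mul_star_apply,
        Set.mem_iUnion, exists_prop]
      constructor
      · rintro ⟨⟨γ, h, h'⟩, rfl⟩
        exact ⟨γ, h, h', rfl⟩
      · rintro ⟨γ, h, h', rfl⟩
        exact ⟨⟨γ, h, h'⟩, rfl⟩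
    -- Below q, the natural order on a projection e says e = eq, the order used for projection
    -- joins.
    have hle : ∀ γ ∈ F, ∀ q, NatLE (π (tau γ * star (tau γ))) q ↔
        π (tau γ) * star (π (tau γ)) * q = π (tau γ) * star (π (tau γ)) := by
      intro γ _ q
      rw [NatLE, hπ.map_mul, hπ.map_star, (hrange γ).isSelfAdjoint.star_eq,
        (hrange γ).isIdempotentElem.eq, eq_comm]
    obtain ⟨-, hub, hleast⟩ := hπ.map_join _ s hU
    rw [hval]
    refine ⟨hproj, ?_, ?_⟩
    · rintro _ ⟨γ, hγ, rfl⟩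
      exact (hle γ hγ _).1 (hub _ ⟨_, Finset.mem_image_of_mem _ hγ, rfl⟩)
    · intro q hq hqe
      have h : π s = π s * star (π s) * q := by
        refine hleast q ?_ ?_
        · change q * star q * q = q
          rw [hq.isSelfAdjoint.star_eq, hq.isIdempotentElem.eq, hq.isIdempotentElem.eq]
        · rintro _ ⟨f, hf, rfl⟩
          obtain ⟨γ, hγ, rfl⟩ := Finset.mem_image.1 hf
          exact (hle γ hγ _).2 (hqe _ ⟨γ, hγ, rfl⟩)
      rw [hproj.isSelfAdjoint.star_eq, hproj.isIdempotentElem.eq] at h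
      exact h.symm

/-- A homomorphism intertwines ρ with π as soon as it does so on the τ_α, so both properties
quantify over the same homomorphisms. -/
theorem isToeplitzAlgebra_iff_isFJUniversal (hfa : FinitelyAligned O) {A : Type w}
    [NonUnitalCStarAlgebra A] {t : Arrow O → A} {ρ : ZM O → A} (ht : IsRep t) (hρ : IsFJRep ρ)
    (h : ∀ α, ρ (tau α) = t α) : IsToeplitzAlgebra A t ↔ IsFJUniversal A ρ := by
  have key : ∀ (B : Type w) [NonUnitalCStarAlgebra B] (π : ZM O → B), IsFJRep π →
      ∀ φ : A →⋆ₙₐ[ℂ] B, (∀ s, φ (ρ s) = π s) ↔ ∀ α, φ (t α) = π (tau α) := by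
    intro B _ π hπ φ
    constructor
    · intro e α
      rw [← h, e]
    · intro e
      refine congrFun ((hρ.toIsZMRep.comp φ).eq_of_tau hπ.toIsZMRep fun α => ?_)
      rw [h, e]
  constructor
  · rintro ⟨-, hu⟩
    refine ⟨hρ, fun B _ π hπ => ?_⟩
    simp only [key B π hπ]
    exact hu B _ hπ.isRep_tau
  · rintro ⟨-, hu⟩
    refine ⟨ht, fun B _ T hT => ?_⟩
    have := hu B _ (hT.isFJRep_extend hfa)
    simpa only [key B _ (hT.isFJRep_extend hfa), hT.extend_tau hfa] using this

end CStar

end LCSC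

theorem theorem7p4 (O : Type u) [Category.{v} O] [LCSC.LeftCancellative O]
    (hfa : LCSC.FinitelyAligned O) :
    -- unique extension, commutativity of the diagram, and bijectivity of `T ↦ π_T`
    (∀ (B : Type w) [NonUnitalCStarAlgebra B],
      ∃ Φ : {T : Arrow O → B // LCSC.IsRep T} → {π : LCSC.ZM O → B // LCSC.IsFJRep π},
        (∀ T α, (Φ T).1 (LCSC.tau α) = T.1 α) ∧
        (∀ T (π : LCSC.ZM O → B), LCSC.IsFJRep π → (∀ α, π (LCSC.tau α) = T.1 α) →
          π = (Φ T).1) ∧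
        (∀ T (D : Type w) [NonUnitalCStarAlgebra D] (ι : LCSC.ZM O → D),
          LCSC.IsFullCStarAlgebra D ι →
          ∀ (A : Type w) [NonUnitalCStarAlgebra A] (t : Arrow O → A),
          LCSC.IsToeplitzAlgebra A t →
          ∃! p : (D →⋆ₙₐ[ℂ] B) × (A →⋆ₙₐ[ℂ] B),
            (∀ s, p.1 (ι s) = (Φ T).1 s) ∧ (∀ α, p.2 (t α) = T.1 α)) ∧
        Function.Bijective Φ) ∧
    -- universality of the Toeplitz algebra for finitely join-preserving representations
    (∀ (A : Type w) [NonUnitalCStarAlgebra A] (t : Arrow O → A) (ρ : LCSC.ZM O → A),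
      LCSC.IsRep t → LCSC.IsFJRep ρ → (∀ α, ρ (LCSC.tau α) = t α) →
      (LCSC.IsToeplitzAlgebra A t ↔ LCSC.IsFJUniversal A ρ)) := by
  refine ⟨fun B _ => ?_, fun A _ t ρ ht hρ h =>
    LCSC.isToeplitzAlgebra_iff_isFJUniversal hfa ht hρ h⟩
  refine ⟨fun T => ⟨T.2.extend hfa, T.2.isFJRep_extend hfa⟩, fun T => T.2.extend_tau hfa,
    fun T π hπ h => hπ.toIsZMRep.eq_of_tau (T.2.isZMRep_extend hfa) fun α => ?_, ?_, ?_, ?_⟩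
  · exact (h α).trans (T.2.extend_tau hfa α).symm
  · intro T D _ ι hD A _ t hA
    obtain ⟨φ, hφ, hφu⟩ := hD.2 B _ (T.2.isZMRep_extend hfa)
    obtain ⟨χ, hχ, hχu⟩ := hA.2 B _ T.2
    exact ⟨(φ, χ), ⟨hφ, hχ⟩, fun p hp => Prod.ext (hφu _ hp.1) (hχu _ hp.2)⟩
  · intro T T' e
    apply Subtype.ext
    funext α
    rw [← T.2.extend_tau hfa, ← T'.2.extend_tau hfa]
    exact congrFun (congrArg Subtype.val e) (LCSC.tau α)
  · rintro ⟨π, hπ⟩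
    refine ⟨⟨_, hπ.isRep_tau⟩, Subtype.ext ?_⟩
    exact (hπ.isRep_tau.isZMRep_extend hfa).eq_of_tau hπ.toIsZMRep
      fun α => hπ.isRep_tau.extend_tau hfa α
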